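/- For a simple graph $\Gamma$ let $A(\Gamma)=\langle V(\Gamma)\mid [u,v]=1 \text{ for every edge } \{u,v\} \text{ of } \Gamma\rangle$ be the right-angled Artin group of $\Gamma$, and let the extension graph $\Gamma^e$ be the graph whose vertices are the elements of $A(\Gamma)$ that are conjugate to a vertex of $\Gamma$, two distinct vertices being adjacent if and only if they commute in $A(\Gamma)$. Let $P_4$ be the path on four vertices. Then every finite forest $F$ (a finite graph that is a disjoint union of trees, i.e. has no cycle) is isomorphic to an induced subgraph of $P_4^e$, and there is an injective group homomorphism $A(F)\to A(P_4)$. -/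

import Mathlib

open scoped commutatorElement

/-- The relations of the right-angled Artin group of `G`: the commutators of adjacent vertices. -/
def raagRels {V : Type*} (G : SimpleGraph V) : Set (FreeGroup V) :=
  {r | ∃ u v : V, G.Adj u v ∧ r = ⁅FreeGroup.of u, FreeGroup.of v⁆}

/-- The right-angled Artin group `A(G)`: generators are the vertices of `G`, and two generators
commute whenever they are adjacent. -/
abbrev RAAG {V : Type*} (G : SimpleGraph V) : Type _ :=
  PresentedGroup (raagRels G)

/-- The vertex `v` of `G`, as an element of `A(G)`. -/
def RAAG.gen {V : Type*} (G : SimpleGraph V) (v : V) : RAAG G :=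
  PresentedGroup.of v

/-- The vertices of the extension graph: the elements of `A(G)` conjugate to a vertex of `G`. -/
def ExtensionVertex {V : Type*} (G : SimpleGraph V) : Type _ :=
  {g : RAAG G // ∃ v : V, IsConj (RAAG.gen G v) g}

/-- The extension graph `Gᵉ`: two distinct conjugates of vertices of `G` are adjacent if and only
if they commute in `A(G)`. -/
def extensionGraph {V : Type*} (G : SimpleGraph V) : SimpleGraph (ExtensionVertex G) where
  Adj x y := x ≠ y ∧ Commute x.1 y.1
  symm := ⟨fun _ _ h => ⟨h.1.symm, h.2.symm⟩⟩
  loopless := ⟨fun _ h => h.1 rfl⟩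

/-! Both claims follow from one injection `A(F) → A(P₄)` sending vertices to conjugates of vertices,
since injective homomorphisms reflect commutation. Such injections (`ConjEmbeds`) compose. They come
from induced subgraphs and from unfoldings, where `A(G.unfold v)` is realised in `A(G)` by
conjugating with powers of `v` (`conjEmbeds_unfold`).

The forest is built leaf by leaf, keeping two spare leaves at every vertex. Unfolding at a spare
leaf of `w` glues copies of the graph along `w` alone, so a neighbour of `w` in another copy serves
as a new leaf with spare leaves of its own (`conjEmbeds_leafed_addLeaf`). The start is an edge with
its spare leaves, found in a double unfolding of `P₄` (`conjEmbeds_leafed_edge`). -/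

namespace RAAG

/-! ### Right-angled Artin groups -/

variable {V W X : Type*} {G : SimpleGraph V} {H : SimpleGraph W} {K : SimpleGraph X}

/-- The universal property of `A(G)`. -/
def lift {M : Type*} [Group M] (f : V → M) (h : ∀ u v, G.Adj u v → Commute (f u) (f v)) :
    RAAG G →* M :=
  PresentedGroup.toGroup (f := f) (by
    rintro r ⟨u, v, huv, rfl⟩
    rw [map_commutatorElement, FreeGroup.lift_apply_of, FreeGroup.lift_apply_of]
    exact commutatorElement_eq_one_iff_commute.2 (h u v huv))

@[simp]
lemma lift_gen {M : Type*} [Group M] (f : V → M) (h : ∀ u v, G.Adj u v → Commute (f u) (f v))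
    (v : V) : lift f h (gen G v) = f v :=
  PresentedGroup.toGroup.of _

lemma hom_ext {M : Type*} [Group M] {φ ψ : RAAG G →* M} (h : ∀ v, φ (gen G v) = ψ (gen G v)) :
    φ = ψ :=
  PresentedGroup.ext h

lemma commute_gen_of_adj {u v : V} (h : G.Adj u v) : Commute (gen G u) (gen G v) := by
  have := PresentedGroup.one_of_mem (rels := raagRels G) ⟨u, v, h, rfl⟩
  rw [map_commutatorElement] at this
  exact commutatorElement_eq_one_iff_commute.1 this

open Classical in
lemma gen_injective : Function.Injective (gen G) := by
  intro u v h
  by_contra hne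
  have := congrArg (lift (G := G) (fun x ↦ if x = u then Multiplicative.ofAdd (1 : ℤ) else 1)
    fun _ _ _ ↦ Commute.all _ _) h
  simp [Ne.symm hne] at this

open Classical in
lemma commute_gen_iff {u v : V} : Commute (gen G u) (gen G v) ↔ u = v ∨ G.Adj u v := by
  refine ⟨fun h ↦ ?_, ?_⟩
  · by_contra! hne
    obtain ⟨hne, hadj⟩ := hne
    -- Non-adjacent `u` and `v` are separated by two non-commuting transpositions.
    let f : V → Equiv.Perm (Fin 3) := fun x ↦
      if x = u then Equiv.swap 0 1 else if x = v then Equiv.swap 1 2 else 1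
    have hf : ∀ x y, G.Adj x y → Commute (f x) (f y) := by
      intro x y hxy
      by_cases hx : x = u <;> by_cases hy : y = u <;> by_cases hx' : x = v <;>
        by_cases hy' : y = v <;> simp_all [f, G.adj_comm]
    have := h.map (lift f hf)
    rw [lift_gen, lift_gen] at this
    simp only [f, if_true, Ne.symm hne, if_false] at this
    exact absurd this.eq (by decide)
  · rintro (rfl | h)
    · exact Commute.refl _
    · exact commute_gen_of_adj h

/-- The homomorphism of right-angled Artin groups induced by a graph homomorphism. -/
def map (f : G →g H) : RAAG G →* RAAG H :=
  lift (fun v ↦ gen H (f v)) fun _ _ h ↦ commute_gen_of_adj (f.map_adj h)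

@[simp]
lemma map_gen (f : G →g H) (v : V) : map f (gen G v) = gen H (f v) :=
  lift_gen _ _ _

-- Killing the vertices outside the image gives a retraction, well defined because the image is
-- induced.
open Classical in
lemma map_injective_of_embedding (e : H ↪g G) : Function.Injective (map e.toHom) := by
  let r : V → RAAG H := fun v ↦ if h : ∃ w, e w = v then gen H h.choose else 1
  have hr (w : W) : r (e w) = gen H w := by
    have h : ∃ w', e w' = e w := ⟨w, rfl⟩
    simp only [r, dif_pos h]
    rw [e.injective h.choose_spec]
  have hcomm : ∀ u v, G.Adj u v → Commute (r u) (r v) := by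
    intro u v huv
    by_cases hu : ∃ w, e w = u
    · by_cases hv : ∃ w, e w = v
      · obtain ⟨u, rfl⟩ := hu
        obtain ⟨v, rfl⟩ := hv
        rw [hr, hr]
        exact commute_gen_of_adj (e.map_adj_iff.1 huv)
      · simp [r, hv]
    · simp [r, hu]
  have : (lift r hcomm).comp (map e.toHom) = MonoidHom.id _ :=
    hom_ext fun w ↦ by simp [hr]
  exact Function.LeftInverse.injective (g := lift r hcomm) fun x ↦ DFunLike.congr_fun this x

/-- There is an injective homomorphism `A(H) → A(G)` which sends every vertex of `H` to a conjugate
of a vertex of `G`. -/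
def ConjEmbeds (H : SimpleGraph W) (G : SimpleGraph V) : Prop :=
  ∃ φ : RAAG H →* RAAG G, Function.Injective φ ∧ ∀ w, ∃ v, IsConj (gen G v) (φ (gen H w))

lemma ConjEmbeds.trans (h₁ : ConjEmbeds K H) (h₂ : ConjEmbeds H G) : ConjEmbeds K G := by
  obtain ⟨φ, hφ, hφc⟩ := h₁
  obtain ⟨ψ, hψ, hψc⟩ := h₂
  refine ⟨ψ.comp φ, hψ.comp hφ, fun x ↦ ?_⟩
  obtain ⟨w, hw⟩ := hφc x
  obtain ⟨v, hv⟩ := hψc w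
  exact ⟨v, hv.trans (ψ.map_isConj hw)⟩

lemma ConjEmbeds.of_embedding (e : H ↪g G) : ConjEmbeds H G :=
  ⟨map e.toHom, map_injective_of_embedding e, fun w ↦ ⟨e w, by rw [map_gen]; exact IsConj.refl _⟩⟩

lemma ConjEmbeds.isIndContained (h : ConjEmbeds H G) :
    SimpleGraph.IsIndContained H (extensionGraph G) := by
  obtain ⟨φ, hφ, hc⟩ := h
  have hinj : Function.Injective fun w ↦ (⟨φ (gen H w), hc w⟩ : ExtensionVertex G) := fun u v huv ↦
    gen_injective (hφ (congrArg Subtype.val huv))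
  refine ⟨⟨⟨_, hinj⟩, ?_⟩⟩
  intro u v
  change (_ ≠ _ ∧ Commute (φ (gen H u)) (φ (gen H v))) ↔ _
  rw [commute_map_iff hφ, commute_gen_iff]
  constructor
  · rintro ⟨hne, rfl | h⟩
    · exact absurd rfl hne
    · exact h
  · exact fun h ↦ ⟨fun he ↦ h.ne (hinj he), Or.inr h⟩

end RAAG

namespace SimpleGraph

variable {V W : Type*}

/-! ### Unfolding at a vertex -/

/-- The vertices of the unfolding of `G` at `v`. -/
@[ext]
structure UnfoldVertex (G : SimpleGraph V) (v : V) where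
  /-- The vertex of `G` below the given vertex. -/
  base : V
  /-- The index of the copy of `G \ v`. -/
  index : ℤ
  base_ne : base ≠ v
  index_eq : G.Adj v base → index = 0

/-- The unfolding of `G` at `v`: copies of `G \ v`, one for each integer, glued along the link
of `v`. -/
def unfold (G : SimpleGraph V) (v : V) : SimpleGraph (UnfoldVertex G v) where
  Adj p q := G.Adj p.base q.base ∧ (p.index = q.index ∨ G.Adj v p.base ∨ G.Adj v q.base)
  symm := ⟨fun _ _ h ↦ ⟨h.1.symm, by tauto⟩⟩
  loopless := ⟨fun _ h ↦ G.loopless.irrefl _ h.1⟩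

open Classical in
/-- The translation by `k` on the vertices of the unfolding. -/
noncomputable def UnfoldVertex.shift {G : SimpleGraph V} {v : V} (k : ℤ) (p : UnfoldVertex G v) :
    UnfoldVertex G v :=
  ⟨p.base, if G.Adj v p.base then 0 else p.index + k, p.base_ne, fun h ↦ if_pos h⟩

/-- The translation by `k` on the unfolding. -/
noncomputable def unfoldShift (G : SimpleGraph V) (v : V) (k : ℤ) : G.unfold v →g G.unfold v where
  toFun p := p.shift k
  map_rel' := by
    rintro p q ⟨h, h'⟩
    refine ⟨h, ?_⟩
    dsimp only [UnfoldVertex.shift]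
    split_ifs <;> simp_all

@[simp]
lemma unfoldShift_apply (G : SimpleGraph V) (v : V) (k : ℤ) (p : UnfoldVertex G v) :
    G.unfoldShift v k p = p.shift k := rfl

lemma UnfoldVertex.shift_shift {G : SimpleGraph V} {v : V} (k l : ℤ) (p : UnfoldVertex G v) :
    (p.shift l).shift k = p.shift (k + l) := by
  ext
  · rfl
  · simp only [shift]
    split_ifs with h
    · simp [h]
    · simp only [h, if_false]
      ring

@[simp]
lemma UnfoldVertex.shift_zero {G : SimpleGraph V} {v : V} (p : UnfoldVertex G v) :
    p.shift 0 = p := by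
  ext
  · rfl
  · simp only [shift, add_zero]
    split_ifs with h
    · exact (p.index_eq h).symm
    · rfl

/-- The action of `ℤ` on the right-angled Artin group of the unfolding. -/
noncomputable def unfoldAction (G : SimpleGraph V) (v : V) :
    Multiplicative ℤ →* MulAut (RAAG (G.unfold v)) where
  toFun k := MonoidHom.toMulEquiv (RAAG.map (G.unfoldShift v k.toAdd))
    (RAAG.map (G.unfoldShift v (-k.toAdd)))
    (RAAG.hom_ext fun p ↦ by simp [UnfoldVertex.shift_shift])
    (RAAG.hom_ext fun p ↦ by simp [UnfoldVertex.shift_shift])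
  map_one' := by
    apply MulEquiv.toMonoidHom_injective
    exact RAAG.hom_ext fun p ↦ by simp
  map_mul' k l := by
    apply MulEquiv.toMonoidHom_injective
    exact RAAG.hom_ext fun p ↦ by simp [UnfoldVertex.shift_shift]

lemma unfoldAction_gen (G : SimpleGraph V) (v : V) (k : Multiplicative ℤ) (p : UnfoldVertex G v) :
    G.unfoldAction v k (RAAG.gen _ p) = RAAG.gen _ (p.shift k.toAdd) :=
  RAAG.map_gen _ _

open Classical in
/-- The homomorphism from `A(G)` to the semidirect product of the right-angled Artin group of the
unfolding by `ℤ`. -/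
noncomputable def toUnfoldSemidirect (G : SimpleGraph V) (v : V) :
    RAAG G →* RAAG (G.unfold v) ⋊[G.unfoldAction v] Multiplicative ℤ :=
  RAAG.lift (fun x ↦ if h : x = v then SemidirectProduct.inr (Multiplicative.ofAdd 1)
    else SemidirectProduct.inl (RAAG.gen _ ⟨x, 0, h, fun _ ↦ rfl⟩)) (by
    have key (y : V) (hy : y ≠ v) (hvy : G.Adj v y) :
        Commute (SemidirectProduct.inr (φ := G.unfoldAction v) (Multiplicative.ofAdd 1))
          (SemidirectProduct.inl (RAAG.gen _ ⟨y, 0, hy, fun _ ↦ rfl⟩)) := by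
      rw [commute_iff_eq, ← mul_inv_eq_iff_eq_mul, ← map_inv, ← SemidirectProduct.inl_aut,
        unfoldAction_gen]
      congr 2
      exact UnfoldVertex.ext rfl (if_pos hvy)
    intro x y hxy
    by_cases hx : x = v
    · subst hx
      rw [dif_pos rfl, dif_neg hxy.ne']
      exact key y _ hxy
    · by_cases hy : y = v
      · subst hy
        rw [dif_pos rfl, dif_neg hxy.ne]
        exact (key x _ hxy.symm).symm
      · rw [dif_neg hx, dif_neg hy]
        refine Commute.map (RAAG.commute_gen_of_adj ?_) _
        exact ⟨hxy, Or.inl rfl⟩)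

/-- The composite with `toUnfoldSemidirect` is the inclusion of the normal factor, whence
injectivity. -/
lemma conjEmbeds_unfold (G : SimpleGraph V) (v : V) : RAAG.ConjEmbeds (G.unfold v) G := by
  let f : UnfoldVertex G v → RAAG G := fun p ↦
    RAAG.gen G v ^ p.index * RAAG.gen G p.base * (RAAG.gen G v ^ p.index)⁻¹
  -- A vertex in the link commutes with `v`, so its image may be conjugated by whichever power its
  -- neighbour uses.
  have hlink (p : UnfoldVertex G v) (hp : G.Adj v p.base) (k : ℤ) :
      f p = RAAG.gen G v ^ k * RAAG.gen G p.base * (RAAG.gen G v ^ k)⁻¹ := by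
    have (j : ℤ) := ((RAAG.commute_gen_of_adj hp).zpow_left j).mul_inv_cancel
    simp only [f, this]
  have hf : ∀ p q, (G.unfold v).Adj p q → Commute (f p) (f q) := by
    rintro p q ⟨h, h' | h' | h'⟩
    · simp only [f, h']
      exact (Commute.conj_iff _).2 (RAAG.commute_gen_of_adj h)
    · rw [hlink p h' q.index]
      exact (Commute.conj_iff _).2 (RAAG.commute_gen_of_adj h)
    · rw [hlink q h' p.index]
      exact (Commute.conj_iff _).2 (RAAG.commute_gen_of_adj h)
  refine ⟨RAAG.lift f hf, ?_, fun p ↦ ⟨p.base, ?_⟩⟩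
  · have : (G.toUnfoldSemidirect v).comp (RAAG.lift f hf) = SemidirectProduct.inl := by
      refine RAAG.hom_ext fun p ↦ ?_
      obtain ⟨x, i, hx, hi⟩ := p
      have h1 : G.toUnfoldSemidirect v (RAAG.gen G v) ^ i =
          SemidirectProduct.inr (Multiplicative.ofAdd i) := by
        rw [toUnfoldSemidirect, RAAG.lift_gen, dif_pos rfl, ← map_zpow, ← ofAdd_zsmul]
        simp
      have h2 : G.toUnfoldSemidirect v (RAAG.gen G x) =
          SemidirectProduct.inl (RAAG.gen _ ⟨x, 0, hx, fun _ ↦ rfl⟩) := by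
        rw [toUnfoldSemidirect, RAAG.lift_gen, dif_neg hx]
      rw [MonoidHom.comp_apply, RAAG.lift_gen]
      simp only [f, map_mul, map_inv, map_zpow, h1, h2]
      rw [← map_inv, ← SemidirectProduct.inl_aut, unfoldAction_gen]
      congr 2
      refine UnfoldVertex.ext rfl ?_
      simp only [UnfoldVertex.shift, toAdd_ofAdd, zero_add]
      split_ifs with h
      · exact (hi h).symm
      · rfl
    refine Function.Injective.of_comp (f := G.toUnfoldSemidirect v) ?_
    rw [← MonoidHom.coe_comp, this]
    exact SemidirectProduct.inl_injective
  · rw [RAAG.lift_gen]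
    exact isConj_iff.2 ⟨_, rfl⟩

/-! ### Graphs with spare leaves -/

/-- The graph `G` with two leaves attached to each vertex. -/
def leafed (G : SimpleGraph V) : SimpleGraph (V × Option Bool) where
  Adj p q := (p.2 = none ∧ q.2 = none ∧ G.Adj p.1 q.1) ∨
    (p.1 = q.1 ∧ (p.2 = none ∧ q.2 ≠ none ∨ p.2 ≠ none ∧ q.2 = none))
  symm := ⟨fun _ _ h ↦ by
    rcases h with ⟨h₁, h₂, h⟩ | ⟨h, h'⟩
    · exact Or.inl ⟨h₂, h₁, h.symm⟩
    · exact Or.inr ⟨h.symm, by tauto⟩⟩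
  loopless := ⟨fun _ h ↦ by
    rcases h with ⟨_, _, h⟩ | ⟨_, h⟩
    · exact G.loopless.irrefl _ h
    · tauto⟩

/-- The graph `G` with a leaf attached to the vertex `w`. -/
def addLeaf (G : SimpleGraph V) (w : V) : SimpleGraph (Option V) where
  Adj
    | some x, some y => G.Adj x y
    | some x, none => x = w
    | none, some y => y = w
    | none, none => False
  symm := ⟨by rintro (_ | x) (_ | y) h <;> first | exact h | exact h.symm⟩
  loopless := ⟨by rintro (_ | x) h; exacts [h, G.loopless.irrefl _ h]⟩

open Classical in
/-- If `y` is a neighbour of `w`, then a leaf `none` can be attached to `w`, with its own two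
leaves, inside the unfolding of `G.leafed` at a leaf of `w`. -/
noncomputable def leafedAddLeafFun (G : SimpleGraph V) {w y : V} (h : G.Adj w y) :
    Option V × Option Bool → UnfoldVertex G.leafed (w, some false)
  | (none, o) => ⟨(y, o), 1, by simp [h.ne'], by simp [leafed, h.ne]⟩
  | (some x, none) => ⟨(x, none), 0, by simp, fun _ ↦ rfl⟩
  | (some x, some b) =>
    -- The unfolding uses up the leaf `(w, some false)`; copies 0 and 1 of the other one replace the
    -- pair.
    if hx : x = w then ⟨(w, some true), if b then 1 else 0, by simp, by simp [leafed]⟩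
    else ⟨(x, some b), 0, by simp [hx], fun _ ↦ rfl⟩

lemma leafedAddLeafFun_injective (G : SimpleGraph V) {w y : V} (h : G.Adj w y) :
    Function.Injective (G.leafedAddLeafFun h) := by
  have := h.ne
  rintro ⟨_ | x, _ | b⟩ ⟨_ | x', _ | b'⟩ he <;> rw [UnfoldVertex.ext_iff] at he <;>
    simp only [leafedAddLeafFun] at he <;> grind

lemma leafedAddLeafFun_adj (G : SimpleGraph V) {w y : V} (h : G.Adj w y)
    (p q : Option V × Option Bool) :
    (G.leafed.unfold (w, some false)).Adj (G.leafedAddLeafFun h p) (G.leafedAddLeafFun h q) ↔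
      (G.addLeaf w).leafed.Adj p q := by
  have h₁ := h.ne
  obtain ⟨_ | x, _ | b⟩ := p <;> obtain ⟨_ | x', _ | b'⟩ := q <;>
    simp only [leafedAddLeafFun] <;> (try split_ifs) <;> simp [unfold, leafed, addLeaf] <;> grind [G.adj_comm]

lemma conjEmbeds_leafed_addLeaf (G : SimpleGraph V) {w y : V} (h : G.Adj w y) :
    RAAG.ConjEmbeds (G.addLeaf w).leafed G.leafed :=
  .trans (.of_embedding ⟨⟨_, G.leafedAddLeafFun_injective h⟩, G.leafedAddLeafFun_adj h _ _⟩)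
    (conjEmbeds_unfold _ (w, some false))

open Classical in
/-- The tree with six vertices `(⊤ : SimpleGraph Bool).leafed`, inside a repeated unfolding of the
path on four vertices. -/
noncomputable def leafedEdgeFun : Bool × Option Bool →
    UnfoldVertex ((pathGraph 4).unfold 0) ⟨3, 0, by decide, fun _ ↦ rfl⟩
  -- The first unfolding glues copies of the path 1, 2, 3 at 1; the second has link the vertex 2 of
  -- copy 0. Central 2 gets its leaves from further outer copies of 1, central 1 from further inner
  -- copies of 2.
  | (false, none) => ⟨⟨2, 0, by decide, fun _ ↦ rfl⟩, 0, by simp, fun _ ↦ rfl⟩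
  | (true, none) => ⟨⟨1, 0, by decide, fun _ ↦ rfl⟩, 0, by simp, fun _ ↦ rfl⟩
  | (false, some b) => ⟨⟨1, 0, by decide, fun _ ↦ rfl⟩, if b then 1 else 2, by simp,
      by simp [unfold, pathGraph_adj]⟩
  | (true, some b) => ⟨⟨2, if b then 1 else 2, by decide, by simp [pathGraph_adj]⟩, 0, by simp,
      fun _ ↦ rfl⟩

lemma leafedEdgeFun_injective : Function.Injective leafedEdgeFun := by
  rintro ⟨_ | _, _ | _ | _⟩ ⟨_ | _, _ | _ | _⟩ <;> simp [leafedEdgeFun]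

lemma leafedEdgeFun_adj (p q : Bool × Option Bool) :
    (((pathGraph 4).unfold 0).unfold ⟨3, 0, by decide, fun _ ↦ rfl⟩).Adj
      (leafedEdgeFun p) (leafedEdgeFun q) ↔ (⊤ : SimpleGraph Bool).leafed.Adj p q := by
  obtain ⟨_ | _, _ | _ | _⟩ := p <;> obtain ⟨_ | _, _ | _ | _⟩ := q <;>
    simp [leafedEdgeFun, unfold, leafed, pathGraph_adj]

lemma conjEmbeds_leafed_edge :
    RAAG.ConjEmbeds (⊤ : SimpleGraph Bool).leafed (pathGraph 4) :=
  .trans (.of_embedding ⟨⟨_, leafedEdgeFun_injective⟩, leafedEdgeFun_adj _ _⟩)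
    (.trans (conjEmbeds_unfold _ _) (conjEmbeds_unfold _ _))

lemma addLeaf_exists_adj {G : SimpleGraph V} (hG : ∀ u, ∃ y, G.Adj u y) (w : V) (u : Option V) :
    ∃ y, (G.addLeaf w).Adj u y := by
  rcases u with _ | u
  · exact ⟨some w, rfl⟩
  · obtain ⟨y, hy⟩ := hG u
    exact ⟨some y, hy⟩

/-- The inclusion of `G` into the graph with a leaf attached. -/
def addLeafEmbedding (G : SimpleGraph V) (w : V) : G ↪g G.addLeaf w where
  toFun := some
  inj' := Option.some_injective _
  map_rel_iff' := Iff.rfl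

/-- The inclusion of a graph into its leafed graph. -/
def leafedEmbedding (G : SimpleGraph V) : G ↪g G.leafed where
  toFun x := (x, none)
  inj' _ _ h := congrArg Prod.fst h
  map_rel_iff' {_ _} :=
    ⟨fun h ↦ h.elim (fun h ↦ h.2.2) (fun h ↦ by tauto), fun h ↦ Or.inl ⟨rfl, rfl, h⟩⟩

/-! ### Induction on the forest -/

/-- A nonempty finite forest has a vertex with at most one neighbour. -/
lemma IsAcyclic.exists_forall_adj_eq [Finite V] [Nonempty V] {G : SimpleGraph V}
    (hG : G.IsAcyclic) : ∃ x z, ∀ y, G.Adj x y → y = z := by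
  -- An end of a longest path works.
  obtain ⟨u, v, p, hp, hmax⟩ := Walk.exists_isPath_forall_isPath_length_le_length G
  refine ⟨u, p.snd, fun y hy ↦ hG.eq_snd_of_adj_start hp hy ?_⟩
  by_contra hns
  have := hmax _ _ (Walk.cons hy.symm p) (hp.cons hns)
  rw [Walk.length_cons] at this
  omega

open Classical in
/-- An embedding of `G \ x` which extends to `x`. -/
lemma nonempty_embedding_of_compl {G : SimpleGraph V} {H : SimpleGraph W} (x : V)
    (e : G.induce {x}ᶜ ↪g H) (a : W) (ha : ∀ y, e y ≠ a)
    (hadj : ∀ y, H.Adj a (e y) ↔ G.Adj x y) : Nonempty (G ↪g H) := by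
  let f : V → W := fun y ↦ if h : y = x then a else e ⟨y, h⟩
  have hx : f x = a := dif_pos rfl
  have hne (y : V) (h : y ≠ x) : f y = e ⟨y, h⟩ := dif_neg h
  refine ⟨⟨⟨f, fun y z hyz ↦ ?_⟩, fun {y z} ↦ ?_⟩⟩
  · by_cases hy : y = x <;> by_cases hz : z = x
    · rw [hy, hz]
    · rw [hy, hx, hne z hz] at hyz
      exact absurd hyz.symm (ha _)
    · rw [hz, hx, hne y hy] at hyz
      exact absurd hyz (ha _)
    · rw [hne y hy, hne z hz] at hyz
      exact congrArg Subtype.val (e.injective hyz)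
  · change H.Adj (f y) (f z) ↔ _
    by_cases hy : y = x <;> by_cases hz : z = x
    · simp [hy, hz]
    · rw [hy, hx, hne z hz]
      exact hadj _
    · rw [hz, hx, hne y hy, H.adj_comm, G.adj_comm]
      exact hadj _
    · rw [hne y hy, hne z hz]
      exact e.map_adj_iff

/-- Every finite forest is an induced subgraph of a graph without isolated vertices, whose leafed
graph embeds into the path on four vertices. -/
lemma IsAcyclic.exists_leafed_conjEmbeds (n : ℕ) {V : Type*} [Finite V] (hn : Nat.card V = n)
    {F : SimpleGraph V} (hF : F.IsAcyclic) :
    ∃ (W : Type) (S : SimpleGraph W), Nonempty W ∧ (∀ w, ∃ y, S.Adj w y) ∧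
      RAAG.ConjEmbeds S.leafed (pathGraph 4) ∧ Nonempty (F ↪g S) := by
  induction n generalizing V with
  | zero =>
    have : IsEmpty V := (Nat.card_eq_zero.1 hn).resolve_right (not_infinite_iff_finite.2 ‹_›)
    exact ⟨Bool, ⊤, inferInstance, fun w ↦ ⟨!w, by simp⟩, conjEmbeds_leafed_edge,
      ⟨⟨⟨isEmptyElim, fun x ↦ isEmptyElim x⟩, fun {x} ↦ isEmptyElim x⟩⟩⟩
  | succ n ih =>
    have : Nonempty V := (Nat.card_pos_iff.1 (by omega)).1
    obtain ⟨x, z, hxz⟩ := hF.exists_forall_adj_eq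
    have hcard : Nat.card ({x}ᶜ : Set V) = n := by
      have := Set.ncard_add_ncard_compl {x}
      rw [Set.ncard_singleton, hn] at this
      rw [Nat.card_coe_set_eq]
      omega
    obtain ⟨W, S, ⟨w⟩, hS, hSP, ⟨e⟩⟩ := ih hcard (hF.induce _)
    have step {W : Type} {S : SimpleGraph W} (w : W) (hS : ∀ w, ∃ y, S.Adj w y)
        (hSP : RAAG.ConjEmbeds S.leafed (pathGraph 4)) :
        RAAG.ConjEmbeds (S.addLeaf w).leafed (pathGraph 4) :=
      (S.conjEmbeds_leafed_addLeaf (hS w).choose_spec).trans hSP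
    by_cases hz : F.Adj x z
    · let w := e ⟨z, hz.ne'⟩
      refine ⟨_, S.addLeaf w, ⟨none⟩, addLeaf_exists_adj hS w, step w hS hSP,
        nonempty_embedding_of_compl x ((S.addLeafEmbedding w).comp e) none
          (fun _ ↦ Option.some_ne_none _) fun y ↦ ?_⟩
      change e y = e _ ↔ _
      rw [e.injective.eq_iff, Subtype.ext_iff]
      exact ⟨fun h ↦ h ▸ hz, hxz _⟩
    -- Here `x` is isolated: a leaf on a new leaf has no neighbour in the image of the rest.
    · have hS' := addLeaf_exists_adj hS w
      refine ⟨_, (S.addLeaf w).addLeaf none, ⟨none⟩, addLeaf_exists_adj hS' _,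
        step none hS' (step w hS hSP),
        nonempty_embedding_of_compl x
          (((S.addLeaf w).addLeafEmbedding none).comp ((S.addLeafEmbedding w).comp e)) none
          (fun _ ↦ Option.some_ne_none _) fun y ↦ iff_of_false (Option.some_ne_none _) ?_⟩
      exact fun h ↦ hz (hxz _ h ▸ h)

end SimpleGraph

theorem theoremt {V : Type*} [Finite V] (F : SimpleGraph V) (hF : F.IsAcyclic) :
    SimpleGraph.IsIndContained F (extensionGraph (SimpleGraph.pathGraph 4)) ∧
      ∃ φ : RAAG F →* RAAG (SimpleGraph.pathGraph 4), Function.Injective φ := by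
  obtain ⟨W, S, -, -, hS, ⟨e⟩⟩ := hF.exists_leafed_conjEmbeds _ rfl
  have h : RAAG.ConjEmbeds F (SimpleGraph.pathGraph 4) :=
    .trans (.of_embedding (S.leafedEmbedding.comp e)) hS
  exact ⟨h.isIndContained, h.imp fun _ hφ ↦ hφ.1⟩
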